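/- A matroid $M=(E,\mathcal B)$ consists of a finite ground set $E$ and a nonempty collection $\mathcal B=\mathcal B(M)$ of subsets of $E$ (the bases) satisfying the basis exchange axiom. Its base polytope is $P(M)=\operatorname{conv}\{\sum_{i\in B}e_i : B\in\mathcal B(M)\}\subset\mathbb R^{E}$. A hyperplane split of $P(M)$ is a decomposition $P(M)=P(M_1)\cup P(M_2)$, where $M_1,M_2$ are matroids on the ground set $E$ and $P(M_1)\cap P(M_2)$ is a face of both $P(M_1)$ and $P(M_2)$; it is nontrivial if $\mathcal B(M_i)\neq\mathcal B(M)$ for $i=1,2$. A matroid $M$ is graphic if there are a graph $G$ (loops and parallel edges allowed) and a bijection between $E$ and the edge set of $G$ under which the bases of $M$ correspond exactly to the edge sets of the spanning forests (maximal forests) of $G$. Corollary 8. If $M$ is a graphic matroid, then $P(M)$ has no nontrivial hyperplane split. In particular, $P(M(K_4))$ has no nontrivial hyperplane split, where $M(K_4)$ is the cycle matroid of the complete graph $K_4$ on four vertices, that is, the matroid whose ground set is the edge set of $K_4$ and whose bases are the edge sets of the spanning trees of $K_4$. -/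

import Mathlib

namespace Graph

/-- `v 0, e 0, v 1, e 1, …, v n, e n, v 0` is a cycle of length `n + 1` of the multigraph `G`:
distinct vertices, distinct edges, and `e i` joins `v i` to its cyclic successor `v (i + 1)`
(addition in `Fin (n + 1)` is cyclic). For `n = 0` this is a loop, for `n = 1` a pair of parallel
edges. -/
structure IsCycle {V β : Type*} (G : Graph V β) {n : ℕ} (v : Fin (n + 1) → V)
    (e : Fin (n + 1) → β) : Prop where
  vertex_injective : Function.Injective v
  edge_injective : Function.Injective e
  isLink : ∀ i, G.IsLink (e i) (v i) (v (i + 1))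

/-- `F` is the edge set of a forest of `G`: a set of edges of `G` that contains no cycle. -/
def IsForest {V β : Type*} (G : Graph V β) (F : Set β) : Prop :=
  F ⊆ G.edgeSet ∧
    ∀ (n : ℕ) (v : Fin (n + 1) → V) (e : Fin (n + 1) → β), G.IsCycle v e → ¬ Set.range e ⊆ F

/-- `F` is the edge set of a spanning forest of `G`, that is, of a maximal forest of `G`
(a spanning tree in every connected component). -/
def IsSpanningForest {V β : Type*} (G : Graph V β) (F : Set β) : Prop :=
  Maximal G.IsForest F

section CycleMatroid

/-- Auxiliary for the construction of the cycle matroid: the simple graph of the pairs of distinct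
vertices joined by an edge from `F`. -/
def adjOn {V β : Type*} (G : Graph V β) (F : Set β) : SimpleGraph V :=
  SimpleGraph.fromRel (fun x y => ∃ e ∈ F, G.IsLink e x y)

theorem adjOn_adj {V β : Type*} {G : Graph V β} {F : Set β} {x y : V} :
    (G.adjOn F).Adj x y ↔ x ≠ y ∧ ∃ e ∈ F, G.IsLink e x y := by
  simp only [adjOn, SimpleGraph.fromRel_adj]
  constructor
  · rintro ⟨h, h' | ⟨e, he, h'⟩⟩
    · exact ⟨h, h'⟩
    · exact ⟨h, e, he, h'.symm⟩
  · rintro ⟨h, h'⟩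
    exact ⟨h, Or.inl h'⟩

theorem IsLink.reachable {V β : Type*} {G : Graph V β} {F : Set β} {e : β} {x y : V}
    (h : G.IsLink e x y) (he : e ∈ F) : (G.adjOn F).Reachable x y := by
  by_cases hxy : x = y
  · subst hxy
    exact SimpleGraph.Reachable.refl _
  · exact (adjOn_adj.2 ⟨hxy, e, he, h⟩).reachable

open Fin.CommRing in
theorem IsCycle.reachable {V β : Type*} {G : Graph V β} {F : Set β} {n : ℕ} {v : Fin (n + 1) → V}
    {e : Fin (n + 1) → β} (h : G.IsCycle v e) (j : Fin (n + 1)) (hF : ∀ i, i ≠ j → e i ∈ F) :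
    (G.adjOn F).Reachable (v (j + 1)) (v j) := by
  have key : ∀ k : ℕ, k ≤ n → (G.adjOn F).Reachable (v (j + 1)) (v (j + 1 + (k : Fin (n + 1)))) := by
    intro k
    induction k with
    | zero => intro _; simp
    | succ k ih =>
      intro hk
      refine (ih (by omega)).trans ?_
      have h1 := h.isLink (j + 1 + (k : Fin (n + 1)))
      have h2 : j + 1 + (k : Fin (n + 1)) ≠ j := by
        intro h3
        have h4 : ((k + 1 : ℕ) : Fin (n + 1)) = 0 := by
          push_cast
          have : j + ((k : Fin (n + 1)) + 1) = j + 0 := by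
            rw [add_zero]; conv_rhs => rw [← h3]
            ring
          exact add_left_cancel this
        have h5 := congrArg Fin.val h4
        rw [Fin.val_natCast, Nat.mod_eq_of_lt (by omega)] at h5
        simp at h5
      have h6 := h1.reachable (hF _ h2)
      have h7 : j + 1 + ((k + 1 : ℕ) : Fin (n + 1)) = j + 1 + (k : Fin (n + 1)) + 1 := by
        push_cast; ring
      rw [h7]
      exact h6
  have := key n le_rfl
  have h8 : j + 1 + (n : Fin (n + 1)) = j := by
    have : ((n + 1 : ℕ) : Fin (n + 1)) = 0 := by simp
    push_cast at this
    calc j + 1 + (n : Fin (n + 1)) = j + ((n : Fin (n + 1)) + 1) := by ring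
      _ = j := by rw [this, add_zero]
  rwa [h8] at this

theorem exists_isCycle {V β : Type*} {G : Graph V β} {F : Set β} {e₀ : β} {x y : V}
    (hl : G.IsLink e₀ x y) (he : e₀ ∉ F) (h : (G.adjOn F).Reachable y x) :
    ∃ (n : ℕ) (v : Fin (n + 1) → V) (e : Fin (n + 1) → β),
      G.IsCycle v e ∧ Set.range e ⊆ insert e₀ F := by
  obtain ⟨p, hp⟩ := h.exists_isPath
  have hstep : ∀ i, i < p.length → ∃ f ∈ F, G.IsLink f (p.getVert i) (p.getVert (i + 1)) :=
    fun i hi => (adjOn_adj.1 (p.adj_getVert_succ hi)).2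
  have : Nonempty β := ⟨e₀⟩
  choose! f hfF hf using hstep
  have hinj : ∀ i j, i ≤ p.length → j ≤ p.length → p.getVert i = p.getVert j → i = j :=
    fun i j hi hj hij => hp.getVert_injOn hi hj hij
  refine ⟨p.length, fun i => p.getVert i, fun i => if i.val < p.length then f i else e₀,
    ⟨?_, ?_, ?_⟩, ?_⟩
  · intro i j hij
    exact Fin.ext (hinj i j (by omega) (by omega) hij)
  · intro i j hij
    dsimp only at hij
    split_ifs at hij with hi hj hj
    · have h1 := hf i hi
      have h2 := hf j hj
      rw [← hij] at h2
      rcases h1.eq_and_eq_or_eq_and_eq h2 with ⟨h3, -⟩ | ⟨h3, h4⟩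
      · exact Fin.ext (hinj i j (by omega) (by omega) h3)
      · have h5 := hinj i (j + 1) (by omega) (by omega) h3
        have h6 := hinj (i + 1) j (by omega) (by omega) h4
        omega
    · exact absurd (hij ▸ hfF i hi) he
    · exact absurd (hij ▸ hfF j hj) he
    · exact Fin.ext (by omega)
  · intro i
    split_ifs with hi
    · have h1 : (i + 1 : Fin (p.length + 1)).val = i.val + 1 :=
        Fin.val_add_one_of_lt' (by omega)
      rw [h1]
      exact hf i hi
    · have hi' : i = Fin.last p.length := Fin.ext (by simp; omega)
      subst hi'
      simpa using hl
  · rintro _ ⟨i, rfl⟩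
    dsimp only
    split_ifs with hi
    · exact Set.mem_insert_of_mem _ (hfF i hi)
    · exact Set.mem_insert _ _

theorem isForest_insert {V β : Type*} {G : Graph V β} {F : Set β} {e₀ : β} {x y : V}
    (hl : G.IsLink e₀ x y) (he : e₀ ∉ F) :
    G.IsForest (insert e₀ F) ↔ G.IsForest F ∧ ¬ (G.adjOn F).Reachable x y := by
  constructor
  · intro h
    refine ⟨⟨fun e h' => h.1 (Set.mem_insert_of_mem _ h'), fun n v e hc hF =>
      h.2 n v e hc (hF.trans (Set.subset_insert _ _))⟩, fun hr => ?_⟩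
    obtain ⟨n, v, e, hc, hF⟩ := exists_isCycle hl he hr.symm
    exact h.2 n v e hc hF
  · rintro ⟨hF, hr⟩
    refine ⟨Set.insert_subset hl.edge_mem hF.1, fun n v e hc hsub => ?_⟩
    by_cases hj : ∃ j, e j = e₀
    · obtain ⟨j, hj⟩ := hj
      have h1 := hc.reachable (F := F) j (fun i hi =>
        (hsub ⟨i, rfl⟩).resolve_left (fun h => hi (hc.edge_injective (h.trans hj.symm))))
      have h2 := hc.isLink j
      rw [hj] at h2
      rcases hl.eq_and_eq_or_eq_and_eq h2 with ⟨rfl, rfl⟩ | ⟨rfl, rfl⟩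
      · exact hr h1.symm
      · exact hr h1
    · push Not at hj
      refine hF.2 n v e hc ?_
      rintro _ ⟨i, rfl⟩
      exact (hsub ⟨i, rfl⟩).resolve_left (hj i)

theorem reachable_iff_mem_span {V β : Type*} {G : Graph V β} {F : Set β} (hF : F ⊆ G.edgeSet)
    {w : β → V →₀ ZMod 2}
    (hw : ∀ e x y, G.IsLink e x y → w e = Finsupp.single x 1 - Finsupp.single y 1) (x y : V) :
    (G.adjOn F).Reachable x y ↔
      Finsupp.single x 1 - Finsupp.single y 1 ∈ Submodule.span (ZMod 2) (w '' F) := by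
  classical
  constructor
  · rintro ⟨p⟩
    induction p with
    | nil => simp
    | @cons a b c hab p ih =>
      obtain ⟨-, e, he, hl⟩ := adjOn_adj.1 hab
      have h1 : Finsupp.single a 1 - Finsupp.single b 1 ∈ Submodule.span (ZMod 2) (w '' F) := by
        rw [← hw e a b hl]
        exact Submodule.subset_span ⟨e, he, rfl⟩
      simpa using add_mem h1 ih
  · intro h
    by_contra hr
    let φ : (V →₀ ZMod 2) →ₗ[ZMod 2] ZMod 2 :=
      Finsupp.linearCombination (ZMod 2) (fun v => if (G.adjOn F).Reachable x v then 1 else 0)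
    have hφ : Submodule.span (ZMod 2) (w '' F) ≤ LinearMap.ker φ := by
      rw [Submodule.span_le]
      rintro _ ⟨e, he, rfl⟩
      obtain ⟨a, b, hl⟩ := G.exists_isLink_of_mem_edgeSet (hF he)
      have hab := hl.reachable he
      have : (G.adjOn F).Reachable x a ↔ (G.adjOn F).Reachable x b :=
        ⟨fun h => h.trans hab, fun h => h.trans hab.symm⟩
      simp [hw e a b hl, φ, this]
    have := hφ h
    simp [φ, hr] at this

/-- Every multigraph has a vector representation over the two-element field (its incidence matrix)
for which the finite forests are the finite linearly independent sets of edges. -/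
theorem exists_incidence {V β : Type*} (G : Graph V β) :
    ∃ w : β → V →₀ ZMod 2,
      (∀ e x y, G.IsLink e x y → w e = Finsupp.single x 1 - Finsupp.single y 1) ∧
      ∀ F : Set β, F.Finite → F ⊆ G.edgeSet → (G.IsForest F ↔ LinearIndepOn (ZMod 2) w F) := by
  have h2 : ∀ a b : V →₀ ZMod 2, a - b = b - a := fun a b => by
    ext v
    simp only [Finsupp.sub_apply]
    rw [CharTwo.sub_eq_add, CharTwo.sub_eq_add, add_comm]
  have hex : ∀ e : β, ∃ z : V →₀ ZMod 2,
      ∀ x y, G.IsLink e x y → z = Finsupp.single x 1 - Finsupp.single y 1 := by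
    intro e
    by_cases he : ∃ a b, G.IsLink e a b
    · obtain ⟨a, b, hab⟩ := he
      refine ⟨Finsupp.single a 1 - Finsupp.single b 1, fun x y hxy => ?_⟩
      rcases hab.eq_and_eq_or_eq_and_eq hxy with ⟨rfl, rfl⟩ | ⟨rfl, rfl⟩
      · rfl
      · exact h2 _ _
    · exact ⟨0, fun x y h => absurd ⟨x, y, h⟩ he⟩
  choose w hw using hex
  refine ⟨w, hw, fun F hfin => ?_⟩
  induction F, hfin using Set.Finite.induction_on with
  | empty =>
    intro _
    refine ⟨fun _ => linearIndepOn_empty _ _, fun _ => ⟨Set.empty_subset _, fun n v e _ h => ?_⟩⟩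
    exact h ⟨0, rfl⟩
  | @insert e F he _ ih =>
    intro hF
    obtain ⟨a, b, hl⟩ := G.exists_isLink_of_mem_edgeSet (hF (Set.mem_insert _ _))
    have hF' := (Set.subset_insert e F).trans hF
    rw [isForest_insert hl he, linearIndepOn_insert he, ih hF', reachable_iff_mem_span hF' hw,
      hw e a b hl]

/-- The cycle matroid `M(G)` of a multigraph with finitely many edges: its ground set is the edge
set of `G`, and its independent sets are the edge sets of forests of `G`. -/
def cycleMatroid {V β : Type*} [Finite β] (G : Graph V β) : Matroid β :=
  (IndepMatroid.ofFinite (E := G.edgeSet) (Set.toFinite _) G.IsForest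
    (by
      refine ⟨Set.empty_subset _, fun n v e _ h => h ⟨0, rfl⟩⟩)
    (fun I J hJ hIJ => ⟨hIJ.trans hJ.1, fun n v e hc h => hJ.2 n v e hc (h.trans hIJ)⟩)
    (by
      intro I J hI hJ hlt
      obtain ⟨w, -, hw⟩ := G.exists_incidence
      by_contra! hcon
      have hIi := (hw I (Set.toFinite _) hI.1).1 hI
      have hJi := (hw J (Set.toFinite _) hJ.1).1 hJ
      have hsub : w '' J ⊆ Submodule.span (ZMod 2) (w '' I) := by
        rintro _ ⟨e, he, rfl⟩
        by_cases heI : e ∈ I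
        · exact Submodule.subset_span ⟨e, heI, rfl⟩
        · by_contra hn
          refine hcon e he heI ?_
          exact (hw _ (Set.toFinite _) (Set.insert_subset (hJ.1 he) hI.1)).2
            ((linearIndepOn_insert heI).2 ⟨hIi, hn⟩)
      have hle : Submodule.span (ZMod 2) (w '' J) ≤ Submodule.span (ZMod 2) (w '' I) :=
        Submodule.span_le.2 hsub
      have : FiniteDimensional (ZMod 2) (Submodule.span (ZMod 2) (w '' I)) :=
        FiniteDimensional.span_of_finite _ (Set.toFinite _)
      have h1 := Submodule.finrank_mono hle
      have hr : ∀ K : Set β, LinearIndepOn (ZMod 2) w K →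
          Module.finrank (ZMod 2) (Submodule.span (ZMod 2) (w '' K)) = K.ncard := by
        intro K hK
        have := Fintype.ofFinite K
        have h3 := finrank_span_eq_card hK
        rw [← Set.image_eq_range] at h3
        rw [h3, ← Nat.card_eq_fintype_card, Nat.card_coe_set_eq]
      rw [hr I hIi, hr J hJi] at h1
      omega)
    (fun I hI => hI.1)).matroid

/-- The bases of the cycle matroid are the spanning forests. -/
theorem cycleMatroid_isBase_iff {V β : Type*} [Finite β] (G : Graph V β) (B : Set β) :
    G.cycleMatroid.IsBase B ↔ G.IsSpanningForest B :=
  Matroid.isBase_iff_maximal_indep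

end CycleMatroid

end Graph

namespace Matroid

/-- `M` is graphic: there are a multigraph `G` and a bijection between the ground set of `M` and
the edge set of `G` under which the bases of `M` correspond to the spanning forests of `G`. -/
def IsGraphic {α : Type*} (M : Matroid α) : Prop :=
  ∃ (V β : Type) (G : Graph V β) (φ : M.E ≃ G.edgeSet),
    ∀ B : Set M.E, M.IsBase (Subtype.val '' B) ↔ G.IsSpanningForest (Subtype.val '' (φ '' B))

/-- The matroid base polytope `P(M)`: the convex hull of the incidence vectors
`∑ i ∈ B, e_i` of the bases `B` of `M`. -/
def basePolytope {α : Type*} (M : Matroid α) : Set (α → ℝ) :=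
  convexHull ℝ ((fun B : Set α => B.indicator (1 : α → ℝ)) '' {B | M.IsBase B})

/-- `P(M) = ⋃ i, P(N i)` is a matroid base polytope decomposition: the `N i` are matroids on the
ground set of `M`, and `P(N i) ∩ P(N j)` is a face of both `P(N i)` and `P(N j)` for `i ≠ j`.
(`IsExposed ℝ P F` says that `F` is empty or the set of maximizers on `P` of a linear functional,
which is a face in the sense of polytope theory.) -/
structure IsBasePolytopeDecomposition {α : Type*} (M : Matroid α) {t : ℕ}
    (N : Fin t → Matroid α) : Prop where
  ground_eq : ∀ i, (N i).E = M.E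
  iUnion_eq : M.basePolytope = ⋃ i, (N i).basePolytope
  isExposed_left : ∀ i j, i ≠ j →
    IsExposed ℝ (N i).basePolytope ((N i).basePolytope ∩ (N j).basePolytope)
  isExposed_right : ∀ i j, i ≠ j →
    IsExposed ℝ (N j).basePolytope ((N i).basePolytope ∩ (N j).basePolytope)

/-- `P(M)` has a nontrivial hyperplane split: a decomposition into `t = 2` base polytopes, neither
of which comes from a matroid with the same bases as `M`. -/
def HasNontrivialHyperplaneSplit {α : Type*} (M : Matroid α) : Prop :=
  ∃ N : Fin 2 → Matroid α, M.IsBasePolytopeDecomposition N ∧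
    ∀ i, {B | (N i).IsBase B} ≠ {B | M.IsBase B}

end Matroid

/-! A 0/1 point of a base polytope is the indicator of a base, so a split writes the bases of `M` as
the union of two base families. If neither family is everything, there are bases B₁ of `N 0` only
and B₂ of `N 1` only; choose them with |B₂ \ B₁| minimal.

At distance one, the midpoint of B₁ and B₂ lies in one of the two pieces, and by
`isBase_of_midpoint_mem` B₁ and B₂ are then both bases of that piece, a contradiction.

At larger distance, two exchanges towards B₁ give B₂ = S ∪ {c, d} and a base S ∪ {a, b} of `M` with
a, b in B₁. By minimality `M` and `N 0` agree on every pair over S that meets {a, b}. Since `M` is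
binary it has no U_{2,4} minor (`IsGraphic.not_forall_pairs`), so one mixed pair is missing, and
exchange in `N 0` then forces S ∪ {c, d} to be a base (`IsGraphic.isBase_of_forall_ne`), a
contradiction. -/

namespace Matroid

/-! ### Points of base polytopes -/

/-- A point of the base polytope is supported on a family of bases that contain every coordinate
equal to `1`, avoid every coordinate equal to `0`, and jointly cover the nonzero coordinates. -/
theorem exists_support_of_mem_basePolytope {α : Type*} {N : Matroid α} {p : α → ℝ}
    (hp : p ∈ N.basePolytope) :
    ∃ 𝒟 : Set (Set α), 𝒟.Nonempty ∧
      (∀ C ∈ 𝒟, N.IsBase C ∧ (∀ i, p i = 1 → i ∈ C) ∧ ∀ i, p i = 0 → i ∉ C) ∧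
      ∀ i, p i ≠ 0 → ∃ C ∈ 𝒟, i ∈ C := by
  classical
  obtain ⟨ι, _, w, z, hw, hsum, hz, hp⟩ := mem_convexHull_iff_exists_fintype.1 hp
  choose C hC hCz using hz
  have hcoord : ∀ k, ∑ j, w j * (C j).indicator (1 : α → ℝ) k = p k := fun k => by
    rw [← hp, Finset.sum_apply]
    simp [← hCz]
  have hnn : ∀ j k, 0 ≤ (C j).indicator (1 : α → ℝ) k := fun j k =>
    Set.indicator_nonneg (fun _ _ => zero_le_one) k
  -- The family consists of the bases of nonzero weight. Each coordinate is a weighted average of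
  -- zeros and ones, so an extreme value 0 or 1 is attained by every one of them.
  refine ⟨C '' {j | w j ≠ 0}, ?_, ?_, ?_⟩
  · have : ∃ j ∈ Finset.univ, w j ≠ 0 :=
      Finset.exists_ne_zero_of_sum_ne_zero (by rw [hsum]; exact one_ne_zero)
    obtain ⟨j, -, hj⟩ := this
    exact ⟨_, j, hj, rfl⟩
  · rintro _ ⟨j, hj, rfl⟩
    refine ⟨hC j, fun k hk => ?_, fun k hk hkC => ?_⟩
    · by_contra hkC
      have h0 : ∑ j, w j * (1 - (C j).indicator (1 : α → ℝ) k) = 0 := by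
        simp only [mul_sub, mul_one, Finset.sum_sub_distrib, hsum, hcoord, hk, sub_self]
      rw [Finset.sum_eq_zero_iff_of_nonneg] at h0
      · have := h0 j (Finset.mem_univ _)
        simp [hkC] at this
        exact hj this
      · intro j _
        refine mul_nonneg (hw j) (sub_nonneg.2 ?_)
        exact Set.indicator_le_self' (fun _ _ => zero_le_one) k
    · have h0 := (hcoord k).trans hk
      rw [Finset.sum_eq_zero_iff_of_nonneg fun j _ => mul_nonneg (hw j) (hnn j k)] at h0
      have := h0 j (Finset.mem_univ _)
      simp [hkC] at this
      exact hj this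
  · intro k hk
    rw [← hcoord k] at hk
    obtain ⟨j, -, hj⟩ := Finset.exists_ne_zero_of_sum_ne_zero hk
    refine ⟨C j, ⟨j, left_ne_zero_of_mul hj, rfl⟩, ?_⟩
    by_contra hkC
    simp [hkC] at hj

/-- All coordinates are extreme here, so any supporting base must be `B` itself. This turns a
covering of polytopes into a union of base families. -/
theorem indicator_mem_basePolytope_iff {α : Type*} {N : Matroid α} {B : Set α} :
    B.indicator (1 : α → ℝ) ∈ N.basePolytope ↔ N.IsBase B := by
  classical
  refine ⟨fun h => ?_, fun h => subset_convexHull _ _ ⟨B, h, rfl⟩⟩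
  obtain ⟨𝒟, ⟨C, hC⟩, h, -⟩ := exists_support_of_mem_basePolytope h
  obtain ⟨hCb, h1, h0⟩ := h C hC
  have : C = B := by
    ext i
    by_cases hi : i ∈ B
    · exact iff_of_true (h1 i (by simp [hi])) hi
    · exact iff_of_false (h0 i (by simp [hi])) hi
  exact this ▸ hCb

/-- If `N` shares the midpoint of the edge between the bases `insert x S` and `insert y S` of `M`
with `M`, and all bases of `N` are bases of `M`, then both ends of the edge are bases of `N`. -/
theorem isBase_of_midpoint_mem {α : Type*} {M N : Matroid α} (hNM : ∀ B, N.IsBase B → M.IsBase B)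
    {S : Set α} {x y : α} (hxy : x ≠ y) (hy : y ∉ S) (hBy : M.IsBase (insert y S))
    (h : midpoint ℝ ((insert x S).indicator (1 : α → ℝ)) ((insert y S).indicator 1) ∈
      N.basePolytope) : N.IsBase (insert y S) := by
  classical
  obtain ⟨𝒟, -, h, hcov⟩ := exists_support_of_mem_basePolytope h
  have hval : ∀ i, midpoint ℝ ((insert x S).indicator (1 : α → ℝ)) ((insert y S).indicator 1) i =
      (2 : ℝ)⁻¹ * ((insert x S).indicator 1 i + (insert y S).indicator 1 i) := fun i => by
    simp [midpoint_eq_smul_add]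
  -- The midpoint is 1/2 at `y` and 1 on `S`: some supporting base contains `y`, and all of them
  -- contain `S`.
  obtain ⟨C, hC, hyC⟩ := hcov y (by rw [hval]; simp [hxy.symm, hy])
  obtain ⟨hCb, h1, -⟩ := h C hC
  have hsub : insert y S ⊆ C := by
    refine Set.insert_subset hyC fun i hi => h1 i ?_
    rw [hval]
    simp [hi]
    norm_num
  rwa [hBy.eq_of_subset_isBase (hNM C hCb) hsub]

/-! ### Rank-two exchange and binary representation -/

/-- The basis exchange axiom in a minor of rank two on four elements. -/
theorem isBase_pair_exchange {α : Type*} {N : Matroid α} {S : Set α} {a b c d : α}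
    (ha : a ∉ S) (hab : a ≠ b) (hac : a ≠ c) (had : a ≠ d)
    (h₁ : N.IsBase (insert a (insert b S))) (h₂ : N.IsBase (insert c (insert d S))) :
    N.IsBase (insert c (insert b S)) ∨ N.IsBase (insert d (insert b S)) := by
  obtain ⟨y, ⟨hy, hy'⟩, h⟩ := h₁.exchange h₂ (e := a) ⟨by simp, by simp [*]⟩
  rw [Set.insert_sdiff_self_of_notMem (by simp [*])] at h
  simp only [Set.mem_insert_iff, not_or] at hy hy'
  rcases hy with rfl | rfl | hy
  · exact Or.inl h
  · exact Or.inr h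
  · exact absurd hy hy'.2.2

/-- A graphic matroid is represented over the two-element field. -/
theorem IsGraphic.exists_rep {α : Type*} [Finite α] {M : Matroid α} (hM : M.IsGraphic) :
    ∃ (V : Type) (w : α → V →₀ ZMod 2), ∀ B, M.IsBase B → LinearIndepOn (ZMod 2) w B ∧
      ∀ e ∈ M.E, w e ∈ Submodule.span (ZMod 2) (w '' B) := by
  classical
  obtain ⟨V, β, G, φ, hφ⟩ := hM
  obtain ⟨w, -, hw⟩ := G.exists_incidence
  have hfin : G.edgeSet.Finite := Set.finite_coe_iff.1 (Finite.of_equiv _ φ)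
  refine ⟨V, fun e => if h : e ∈ M.E then w (φ ⟨e, h⟩) else 0, fun B hB => ?_⟩
  set u : α → V →₀ ZMod 2 := fun e => if h : e ∈ M.E then w (φ ⟨e, h⟩) else 0 with hu
  have hval : ∀ e : M.E, u e = w (φ e) := fun e => by simp [hu]
  obtain ⟨B, rfl⟩ : ∃ B' : Set M.E, Subtype.val '' B' = B :=
    ⟨Subtype.val ⁻¹' B, by simpa using hB.subset_ground⟩
  have hF := (hφ B).1 hB
  set F : Set β := Subtype.val '' (φ '' B) with hFdef
  have himg : u '' (Subtype.val '' B) = w '' F := by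
    simp only [hFdef, Set.image_image, hval]
  have hli := (hw F (hfin.subset hF.prop.1) hF.prop.1).1 hF.prop
  constructor
  · refine LinearIndepOn.image_of_comp (s := B) (Subtype.val : M.E → α) u ?_
    have hcomp : u ∘ (Subtype.val : M.E → α) = w ∘ fun e => (φ e : β) := funext hval
    rw [hcomp]
    refine LinearIndepOn.comp_of_image ?_ (Subtype.val_injective.comp φ.injective).injOn
    rwa [hFdef, Set.image_image] at hli
  · intro e he
    rw [himg, show u e = w (φ ⟨e, he⟩) from hval ⟨e, he⟩]
    by_cases heF : (φ ⟨e, he⟩ : β) ∈ F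
    · exact Submodule.subset_span ⟨_, heF, rfl⟩
    -- A vector outside the span would extend `F` to a larger forest.
    · by_contra hn
      have hsub : insert (φ ⟨e, he⟩ : β) F ⊆ G.edgeSet :=
        Set.insert_subset (φ ⟨e, he⟩).2 hF.prop.1
      exact heF (hF.le_of_ge ((hw _ (hfin.subset hsub) hsub).2
        ((linearIndepOn_insert heF).2 ⟨hli, hn⟩)) (Set.subset_insert _ _) (Set.mem_insert _ _))

/-- A graphic matroid has no minor isomorphic to `U_{2,4}`. -/
theorem IsGraphic.not_forall_pairs {α : Type*} [Finite α] {M : Matroid α} (hM : M.IsGraphic)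
    {S : Set α} {a b c d : α} (ha : a ∉ S) (hb : b ∉ S) (hc : c ∉ S) (hd : d ∉ S)
    (hac : a ≠ c) (had : a ≠ d) (hbc : b ≠ c) (hbd : b ≠ d) (hcd : c ≠ d)
    (h₁ : M.IsBase (insert a (insert b S))) (h₂ : M.IsBase (insert c (insert d S)))
    (h₃ : M.IsBase (insert a (insert c S))) (h₄ : M.IsBase (insert a (insert d S)))
    (h₅ : M.IsBase (insert b (insert c S))) (h₆ : M.IsBase (insert b (insert d S))) : False := by
  obtain ⟨V, w, hw⟩ := hM.exists_rep
  have hzmod : ∀ t : ZMod 2, t = 0 ∨ t = 1 := by decide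
  -- Modulo the span of `S`, `w e` is a combination of `w a` and `w b`. A zero coefficient would
  -- contradict the independence of `S` with `e` and one of `a`, `b`. Over the two-element field
  -- both coefficients are therefore 1.
  have key : ∀ e ∈ M.E, M.IsBase (insert a (insert e S)) → M.IsBase (insert b (insert e S)) →
      e ∉ S → a ≠ e → b ≠ e → w e - (w a + w b) ∈ Submodule.span (ZMod 2) (w '' S) := by
    intro e he hae hbe heS hne hne'
    have h := (hw _ h₁).2 e he
    rw [Set.image_insert_eq, Set.image_insert_eq, Submodule.mem_span_insert] at h
    obtain ⟨s, z, hz, h⟩ := h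
    obtain ⟨t, u, hu, rfl⟩ := Submodule.mem_span_insert.1 hz
    have hi := ((linearIndepOn_insert (by simp [*])).1 (hw _ hae).1).2
    have hi' := ((linearIndepOn_insert (by simp [*])).1 (hw _ hbe).1).2
    rw [Set.image_insert_eq] at hi hi'
    have hmem : ∀ v ∈ Submodule.span (ZMod 2) (w '' S),
        v ∈ Submodule.span (ZMod 2) (insert (w e) (w '' S)) := fun v hv =>
      Submodule.span_mono (Set.subset_insert _ _) hv
    have hemem : w e ∈ Submodule.span (ZMod 2) (insert (w e) (w '' S)) :=
      Submodule.subset_span (Set.mem_insert _ _)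
    have hei : w e ∉ Submodule.span (ZMod 2) (w '' S) := by
      have := (hw _ hae).1.mono (Set.subset_insert _ _)
      exact ((linearIndepOn_insert heS).1 this).2
    rcases hzmod s with rfl | rfl <;> rcases hzmod t with rfl | rfl
    · simp only [zero_smul, zero_add] at h
      exact absurd (h ▸ hu) hei
    · refine absurd ?_ hi'
      have : w b = w e - u := by rw [h]; simp
      rw [this]
      exact sub_mem hemem (hmem u hu)
    · refine absurd ?_ hi
      have : w a = w e - u := by rw [h]; simp
      rw [this]
      exact sub_mem hemem (hmem u hu)
    · have : w e - (w a + w b) = u := by rw [h]; simp only [one_smul]; abel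
      rwa [this]
  -- `w c` and `w d` are both congruent to `w a + w b`, hence to each other, although `c` and `d`
  -- are independent over `S`.
  have h := sub_mem (key c (h₂.subset_ground (by simp)) h₃ h₅ hc hac hbc)
    (key d (h₂.subset_ground (by simp)) h₄ h₆ hd had hbd)
  rw [sub_sub_sub_cancel_right] at h
  refine ((linearIndepOn_insert (by simp [*])).1 (hw _ h₂).1).2 ?_
  rw [Set.image_insert_eq, ← sub_add_cancel (w c) (w d)]
  exact add_mem (Submodule.span_mono (Set.subset_insert _ _) h)
    (Submodule.subset_span (Set.mem_insert _ _))

/-- If `S ∪ {a, b}` and `S ∪ {c, d}` are bases of a graphic matroid `M`, then a matroid `N` that has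
the same bases of the form `S ∪ {x, y}` with `x ∈ {a, b}` also has the basis `S ∪ {c, d}`. -/
theorem IsGraphic.isBase_of_forall_ne {α : Type*} [Finite α] {M N : Matroid α} (hM : M.IsGraphic)
    {S : Set α} {a b c d : α} (ha : a ∉ S) (hb : b ∉ S) (hc : c ∉ S) (hd : d ∉ S)
    (hab : a ≠ b) (hac : a ≠ c) (had : a ≠ d) (hbc : b ≠ c) (hbd : b ≠ d) (hcd : c ≠ d)
    (h₁ : M.IsBase (insert a (insert b S))) (h₂ : M.IsBase (insert c (insert d S)))
    (hN : ∀ x ∈ ({a, b} : Set α), ∀ y ∈ ({a, b, c, d} : Set α),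
      M.IsBase (insert x (insert y S)) ↔ N.IsBase (insert x (insert y S))) :
    N.IsBase (insert c (insert d S)) := by
  by_contra hcon
  have n1 := hN a (by simp) b (by simp)
  have n3 := hN a (by simp) c (by simp)
  have n4 := hN a (by simp) d (by simp)
  have n5 := hN b (by simp) c (by simp)
  have n6 := hN b (by simp) d (by simp)
  -- One of the pairs ac, ad, bc, bd is not a base of `M`. If it is ac, then `e2` and `e4` make ad
  -- and bc bases of `M`, hence of `N`, and `f3` yields ac or cd in `N`; ac is excluded. The other
  -- three cases are symmetric, with one `f` for each missing pair.
  have hU := hM.not_forall_pairs ha hb hc hd hac had hbc hbd hcd h₁ h₂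
  have e1 := isBase_pair_exchange ha hab hac had h₁ h₂
  have e2 := isBase_pair_exchange hb hab.symm hbc hbd (Set.insert_comm a b S ▸ h₁) h₂
  have e3 := isBase_pair_exchange hc hcd hac.symm hbc.symm h₂ h₁
  have e4 := isBase_pair_exchange hd hcd.symm had.symm hbd.symm (Set.insert_comm c d S ▸ h₂) h₁
  have f1 := isBase_pair_exchange (N := N) (S := S) hb hbd hab.symm hbc
  have f2 := isBase_pair_exchange (N := N) (S := S) ha hac hab had
  have f3 := isBase_pair_exchange (N := N) (S := S) hb hbc hab.symm hbd
  have f4 := isBase_pair_exchange (N := N) (S := S) ha had hab hac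
  -- Each unordered pair is brought to a single form, which leaves a propositional problem.
  have ca := Set.insert_comm c a S
  have cb := Set.insert_comm c b S
  have da := Set.insert_comm d a S
  have db := Set.insert_comm d b S
  have ba := Set.insert_comm b a S
  have dc := Set.insert_comm d c S
  simp only [ca, cb, da, db, ba, dc] at *
  clear ca cb da db ba dc
  grind

/-! ### Nonexistence of a split -/

theorem IsGraphic.not_hasNontrivialHyperplaneSplit {α : Type*} [Finite α] {M : Matroid α}
    (hM : M.IsGraphic) : ¬ M.HasNontrivialHyperplaneSplit := by
  classical
  rintro ⟨N, hN, hne⟩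
  have hunion : M.basePolytope = (N 0).basePolytope ∪ (N 1).basePolytope := by
    rw [hN.iUnion_eq]
    ext; simp [Fin.exists_fin_two]
  have hbase : ∀ B, M.IsBase B ↔ (N 0).IsBase B ∨ (N 1).IsBase B := fun B => by
    simp only [← indicator_mem_basePolytope_iff, hunion, Set.mem_union]
  have hex : ∀ i j, (∀ B, M.IsBase B ↔ (N i).IsBase B ∨ (N j).IsBase B) →
      ∃ B, (N i).IsBase B ∧ ¬ (N j).IsBase B := by
    intro i j hij
    by_contra! hcon
    exact hne j (Set.ext fun B => ⟨fun h => (hij B).2 (Or.inr h),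
      fun h => ((hij B).1 h).elim (hcon B) id⟩)
  have hpair : ∃ k B₁ B₂, (N 0).IsBase B₁ ∧ ¬ (N 1).IsBase B₁ ∧ (N 1).IsBase B₂ ∧
      ¬ (N 0).IsBase B₂ ∧ (B₂ \ B₁).ncard = k := by
    obtain ⟨B₁, h₁, h₁'⟩ := hex 0 1 hbase
    obtain ⟨B₂, h₂, h₂'⟩ := hex 1 0 fun B => (hbase B).trans or_comm
    exact ⟨_, B₁, B₂, h₁, h₁', h₂, h₂', rfl⟩
  obtain ⟨B₁, B₂, h₁, h₁', h₂, h₂', hk⟩ := Nat.find_spec hpair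
  -- With `B₁` kept fixed, a base belonging to `N 1` only and nearer to `B₁` would replace `B₂`.
  have hmin : ∀ B, (N 1).IsBase B → (B \ B₁).ncard < (B₂ \ B₁).ncard → (N 0).IsBase B := by
    intro B hB hlt
    by_contra hB'
    exact Nat.find_min hpair (hlt.trans_eq hk) ⟨B₁, B, h₁, h₁', hB, hB', rfl⟩
  have hmin' : ∀ B, M.IsBase B → (B \ B₁).ncard < (B₂ \ B₁).ncard → (N 0).IsBase B :=
    fun B hB hlt => ((hbase B).1 hB).elim id fun h => hmin B h hlt
  have hB₁ := (hbase B₁).2 (Or.inl h₁)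
  have hB₂ := (hbase B₂).2 (Or.inr h₂)
  have hnsub : ¬ B₂ ⊆ B₁ := fun h => h₂' (hB₂.eq_of_subset_isBase hB₁ h ▸ h₁)
  obtain ⟨c, hc, hc'⟩ := Set.not_subset.1 hnsub
  obtain ⟨a, ⟨ha, ha'⟩, h₃⟩ := hB₂.exchange hB₁ (e := c) ⟨hc, hc'⟩
  by_cases hd : ∃ d ∈ B₂ \ B₁, d ≠ c
  · obtain ⟨d, ⟨hd, hd'⟩, hdc⟩ := hd
    have hac : a ≠ c := fun h => ha' (h ▸ hc)
    have had : a ≠ d := fun h => ha' (h ▸ hd)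
    -- The second exchange starts from `B₂` with `c` already replaced by `a`, so `b` is new and also
    -- lies in `B₁ \ B₂`.
    obtain ⟨b, ⟨hb, hb'⟩, h₄⟩ := h₃.exchange hB₁ (e := d) ⟨by simp [hd, hdc], hd'⟩
    have hbB₂ : b ∉ B₂ := fun h => hb' (Set.mem_insert_of_mem _
      ⟨h, fun h' => hc' (Set.mem_singleton_iff.1 h' ▸ hb)⟩)
    have hba : b ≠ a := fun h => hb' (h ▸ Set.mem_insert _ _)
    have hbc : b ≠ c := fun h => hbB₂ (h ▸ hc)
    have hbd : b ≠ d := fun h => hbB₂ (h ▸ hd)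
    set S := B₂ \ {c, d} with hS
    have hB₂S : insert c (insert d S) = B₂ := by
      ext i; simp only [hS, Set.mem_insert_iff, Set.mem_sdiff, Set.mem_singleton_iff]; grind
    have h₄' : M.IsBase (insert b (insert a S)) := by
      convert h₄ using 2
      ext i; simp only [hS, Set.mem_insert_iff, Set.mem_sdiff, Set.mem_singleton_iff]; grind
    refine h₂' (hB₂S ▸ hM.isBase_of_forall_ne (N := N 0) (S := S) (a := b) (b := a) (c := c)
      (d := d) ?_ ?_ ?_ ?_ hba hbc hbd hac had hdc.symm h₄' (hB₂S.symm ▸ hB₂) ?_)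
    · exact fun h => hbB₂ h.1
    · exact fun h => ha' h.1
    · simp [hS]
    · simp [hS]
    · intro x hx y hy
      -- Since `x` is in `B₁`, at most one of `c`, `d` survives, and `y` adds nothing outside `B₁ ∪
      -- B₂`. The difference from `B₁` is thus a proper subset of `B₂ \ B₁`.
      refine ⟨fun h => hmin' _ h (Set.ncard_lt_ncard ?_ (Set.toFinite _)),
        fun h => (hbase _).2 (Or.inl h)⟩
      have hxB : x ∈ B₁ := by rcases hx with rfl | rfl <;> assumption
      refine ⟨?_, ?_⟩
      · rintro i ⟨hi, hi'⟩
        refine ⟨?_, hi'⟩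
        simp only [hS, Set.mem_insert_iff, Set.mem_sdiff, Set.mem_singleton_iff] at hi hy
        grind
      · intro hsub
        have hmc := (hsub ⟨hc, hc'⟩).1
        have hmd := (hsub ⟨hd, hd'⟩).1
        simp only [hS, Set.mem_insert_iff, Set.mem_sdiff, Set.mem_singleton_iff] at hmc hmd
        grind
  -- Here `B₂ \ B₁ = {c}`, so the two bases differ by a single exchange.
  · push Not at hd
    set S := B₂ \ {c} with hS
    have hB₂S : insert c S = B₂ := by simp [hS, Set.insert_eq_of_mem hc]
    have hSB : insert a S ⊆ B₁ := by
      refine Set.insert_subset ha ?_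
      rintro i ⟨hi, hic⟩
      by_contra hi'
      exact hic (hd i ⟨hi, hi'⟩)
    have hB₁S : insert a S = B₁ := h₃.eq_of_subset_isBase hB₁ hSB
    have hac : a ≠ c := fun h => ha' (h ▸ hc)
    have haS : a ∉ S := fun h => ha' h.1
    have hcS : c ∉ S := by simp [hS]
    have hmid : midpoint ℝ (B₁.indicator (1 : α → ℝ)) (B₂.indicator 1) ∈ M.basePolytope :=
      (convex_convexHull ℝ _).midpoint_mem (indicator_mem_basePolytope_iff.2 hB₁)
        (indicator_mem_basePolytope_iff.2 hB₂)
    rw [hunion, ← hB₁S, ← hB₂S] at hmid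
    rcases hmid with hmid | hmid
    · exact h₂' (hB₂S ▸ isBase_of_midpoint_mem (fun B hB => (hbase B).2 (Or.inl hB)) hac hcS
        (hB₂S.symm ▸ hB₂) hmid)
    · rw [midpoint_comm] at hmid
      exact h₁' (hB₁S ▸ isBase_of_midpoint_mem (fun B hB => (hbase B).2 (Or.inr hB)) hac.symm
        haS h₃ hmid)

end Matroid

theorem Graph.cycleMatroid_isGraphic {V β : Type} [Finite β] (G : Graph V β) :
    G.cycleMatroid.IsGraphic :=
  have h : ∀ B : Set G.edgeSet, G.cycleMatroid.IsBase (Subtype.val '' B) ↔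
      G.IsSpanningForest (Subtype.val '' (Equiv.refl G.edgeSet '' B)) := fun B => by
    rw [G.cycleMatroid_isBase_iff, Equiv.coe_refl, Set.image_id]
  ⟨V, β, G, Equiv.refl G.edgeSet, h⟩

theorem corollary8 :
    (∀ (α : Type*) [Finite α] (M : Matroid α), M.IsGraphic → ¬ M.HasNontrivialHyperplaneSplit) ∧
      ¬ (Graph.ofSimpleGraph (⊤ : SimpleGraph (Fin 4))).cycleMatroid.HasNontrivialHyperplaneSplit :=
  ⟨fun _ _ _ hM => hM.not_hasNontrivialHyperplaneSplit,
    (Graph.cycleMatroid_isGraphic _).not_hasNontrivialHyperplaneSplit⟩
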